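/- Let $m$ be the Lebesgue measure on the unit circle $\mathbb T$, normalized by $m(\mathbb T)=1$. For a finite positive Borel measure $\rho$ on $\mathbb T$ put \[ e_n(\rho)=\min_{q_0,\dots,q_{n-1}\in\mathbb C}\Bigl(\int_{\mathbb T}|q_0+q_1t+\dots+q_{n-1}t^{n-1}+t^n|^2\,d\rho(t)\Bigr)^{1/2}. \] Let $H\colon\mathbb T\to[0,+\infty]$ be measurable with $\int_{\mathbb T}H\,dm=+\infty$, and let $\lambda_H(a)=m\{H>a\}$. Let $\varphi\colon[0,\tfrac12]\to(0,+\infty]$ be continuous and (strictly) decreasing with $\varphi(0)=+\infty$ and $\varphi(\tfrac12)\le\inf_{\mathbb T}H$. For $\tau\in[-\tfrac12,\tfrac12]$ let $\theta_\tau\in[0,\tfrac12]$ be the solution of $\varphi(\theta_\tau)=H(e^{2\pi i\tau})$. Suppose that $H$ is subordinated to $\varphi$, that is, for every $\tau\in[-\tfrac12,\tfrac12]$, \[ H(e^{2\pi i\theta})\le\varphi(\theta+\theta_\tau-\tau)\quad(\tau-\theta_\tau<\theta\le\tau),\qquad H(e^{2\pi i\theta})\le\varphi(\tau+\theta_\tau-\theta)\quad(\tau\le\theta<\tau+\theta_\tau).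 \] Suppose also that $\varphi$ is regular, that is, there are constants $c>0$ and $C<\infty$ such that at least one of the following two conditions holds: (Reg1) the function $\theta\mapsto\theta\varphi(\theta)$ is non-decreasing on $(0,\tfrac12]$, and $\varphi(\theta)\ge c\log\frac1\theta$ for $0<\theta\le\tfrac12$; (Reg2) $\varphi(\theta/2)\le C\varphi(\theta)$ and $\varphi(\theta)\ge c/\theta$ for $0<\theta\le\tfrac12$. Suppose finally that $\int_{\mathbb T}e^{H}\,d\rho<\infty$, and that there is a constant $c'>0$ with $\log\varphi(\theta)\ge c'\log\frac1\theta$ for all sufficiently small $\theta>0$. (a) If $\liminf_{a\to\infty}a\lambda_H(a)>0$, then $e_n(\rho)$ decays at least like a negative power of $n$: there is $p>0$ such that $e_n(\rho)=O(n^{-p})$ as $n\to\infty$. (b) If $\lim_{a\to\infty}a\lambda_H(a)=\infty$, then $e_n(\rho)$ decays faster than any negative power of $n$: for every $p>0$, $e_n(\rho)=o(n^{-p})$ as $n\to\infty$. -/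

import Mathlib

open Set Filter Topology MeasureTheory
open scoped ENNReal NNReal

noncomputable section

namespace SzegoMin

/-- The point `t = exp (2 π i θ)` of the unit circle in `ℂ`, for `θ ∈ ℝ/ℤ`. The circle `𝕋` is
identified throughout with `ℝ/ℤ` by this map. -/
def pt (θ : UnitAddCircle) : ℂ := (AddCircle.toCircle θ : ℂ)

/-- `e_n(ρ)`: the distance in `L²(ρ)` from `t ^ n` to the polynomials of degree at most `n - 1`,
i.e. the minimal `L²(ρ)`-norm of a monic polynomial of degree `n`. -/
def szegoError (ρ : Measure UnitAddCircle) (n : ℕ) : ℝ :=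
  ⨅ q : Fin n → ℂ, √(∫ θ, ‖(∑ j : Fin n, q j * pt θ ^ (j : ℕ)) + pt θ ^ n‖ ^ 2 ∂ρ)

/-- The distribution function `λ_H(a) = m {H > a}`, `m` being the Lebesgue measure on the circle,
normalized to have total mass one. -/
def distribution (H : UnitAddCircle → ℝ≥0∞) (a : ℝ) : ℝ≥0∞ :=
  AddCircle.haarAddCircle {t : UnitAddCircle | ENNReal.ofReal a < H t}

/-- `φ : [0, 1/2] → (0, ∞]` is continuous and (strictly) decreasing, with `φ 0 = ∞`.
Values of `φ` outside `[0, 1/2]` play no role. -/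
structure IsMajorant (φ : ℝ → ℝ≥0∞) : Prop where
  continuousOn : ContinuousOn φ (Icc 0 (1 / 2))
  strictAntiOn : StrictAntiOn φ (Icc 0 (1 / 2))
  pos : ∀ θ ∈ Icc (0 : ℝ) (1 / 2), 0 < φ θ
  map_zero : φ 0 = ∞

/-- `H` is subordinated to `φ`. In the last two fields `s` is the (unique) solution `θ_τ` of
`φ s = H (exp (2 π i τ))`; it exists by the first two fields. -/
structure Subordinated (H : UnitAddCircle → ℝ≥0∞) (φ : ℝ → ℝ≥0∞) : Prop where
  majorant : IsMajorant φ
  le_inf : φ (1 / 2) ≤ ⨅ t, H t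
  left : ∀ τ ∈ Icc (-(1 / 2) : ℝ) (1 / 2), ∀ s ∈ Icc (0 : ℝ) (1 / 2),
    φ s = H (τ : UnitAddCircle) →
      ∀ θ : ℝ, τ - s < θ → θ ≤ τ → H (θ : UnitAddCircle) ≤ φ (θ + s - τ)
  right : ∀ τ ∈ Icc (-(1 / 2) : ℝ) (1 / 2), ∀ s ∈ Icc (0 : ℝ) (1 / 2),
    φ s = H (τ : UnitAddCircle) →
      ∀ θ : ℝ, τ ≤ θ → θ < τ + s → H (θ : UnitAddCircle) ≤ φ (τ + s - θ)

/-- First regularity condition: `θ ↦ θ φ(θ)` does not decrease and `φ(θ) ≳ log (1/θ)`. -/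
def Reg1 (φ : ℝ → ℝ≥0∞) : Prop :=
  MonotoneOn (fun θ : ℝ => ENNReal.ofReal θ * φ θ) (Ioc 0 (1 / 2)) ∧
    ∃ c : ℝ, 0 < c ∧ ∀ θ ∈ Ioc (0 : ℝ) (1 / 2), ENNReal.ofReal (c * Real.log (1 / θ)) ≤ φ θ

/-- Second regularity condition: `φ(θ/2) ≲ φ(θ)` and `φ(θ) ≳ 1/θ`. -/
def Reg2 (φ : ℝ → ℝ≥0∞) : Prop :=
  (∃ C : ℝ≥0, ∀ θ ∈ Ioc (0 : ℝ) (1 / 2), φ (θ / 2) ≤ C * φ θ) ∧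
    ∃ c : ℝ, 0 < c ∧ ∀ θ ∈ Ioc (0 : ℝ) (1 / 2), ENNReal.ofReal (c * (1 / θ)) ≤ φ θ

/-- `φ` is regular if at least one of the two conditions holds. -/
def Regular (φ : ℝ → ℝ≥0∞) : Prop := Reg1 φ ∨ Reg2 φ

end SzegoMin

end

/-!
The test polynomial is a truncation of `exp (κ * q)`, where the real part of `q` on the circle is a
Fejér mean of `min (H, a)`, with `a` a small power of `n`; the extremal problem is normalized at the
origin instead of at infinity. Subordination, the doubling of `φ` and its power growth make
`min (H, a)` constant up to a factor `C` over distances `a ^ (-k)`, so a Fejér mean of order a power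
of `a` is at most `C * min (H, a) + 1`. Hence, for `κ = 1 / (2 * C)`, the `L²(ρ)`-norm of the test
polynomial is controlled by `∫ exp H dρ`, while its modulus at the origin is about
`exp (κ * ∫ min (H, a) dm)`. By the layer-cake formula the last integral is
`∫ λ_H (t) dt` over `(0, a)`, which is at least `D * log a - O(1)` as soon as `t * λ_H (t) ≥ D` for
large `t`.
-/

namespace SzegoMin

open Polynomial
open AddCircle (haarAddCircle)
open scoped ComplexConjugate

section Circle

lemma norm_pt (θ : UnitAddCircle) : ‖pt θ‖ = 1 := Circle.norm_coe _

lemma continuous_pt : Continuous pt :=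
  continuous_subtype_val.comp AddCircle.continuous_toCircle

lemma pt_sub (s t : UnitAddCircle) : pt (s - t) = pt s * conj (pt t) := by
  simp only [pt, sub_eq_add_neg, AddCircle.toCircle_add, AddCircle.toCircle_neg, Circle.coe_mul,
    Circle.coe_inv_eq_conj]

lemma norm_mul_conj_pt (z : ℂ) (θ : UnitAddCircle) : ‖z * conj (pt θ)‖ = ‖z‖ := by
  rw [norm_mul, RCLike.norm_conj, norm_pt, mul_one]

lemma integral_pt_pow (k : ℕ) : ∫ s, pt s ^ k ∂haarAddCircle = (0 : ℂ) ^ k := by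
  have hpow (s : UnitAddCircle) : fourier (k : ℤ) s = pt s ^ k := by
    rw [fourier_apply, natCast_zsmul, AddCircle.toCircle_nsmul, Circle.coe_pow, pt]
  have h := congrFun (fourierCoeff_fourier (T := 1) (k : ℤ)) 0
  simp only [fourierCoeff, neg_zero, fourier_zero, one_smul, hpow] at h
  rw [h]
  rcases eq_or_ne k 0 with rfl | hk
  · simp
  · rw [zero_pow hk, Pi.single_eq_of_ne (by exact_mod_cast hk.symm)]

lemma exists_coe_eq_and_abs_eq_norm (x : UnitAddCircle) :
    ∃ d : ℝ, (d : UnitAddCircle) = x ∧ |d| = ‖x‖ := by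
  induction x using QuotientAddGroup.induction_on with
  | H z =>
    refine ⟨z - round z, ?_, UnitAddCircle.norm_eq.symm⟩
    rw [AddCircle.coe_sub, sub_eq_self, AddCircle.coe_eq_zero_iff]
    exact ⟨round z, by simp⟩

lemma norm_le_half (x : UnitAddCircle) : ‖x‖ ≤ 1 / 2 := by
  simpa using AddCircle.norm_le_half_period 1 one_ne_zero (x := x)

lemma four_mul_norm_le_norm_pt_sub_one (x : UnitAddCircle) : 4 * ‖x‖ ≤ ‖pt x - 1‖ := by
  obtain ⟨d, rfl, hd⟩ := exists_coe_eq_and_abs_eq_norm x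
  have hpt : pt (d : UnitAddCircle) = Complex.exp (Complex.I * (2 * Real.pi * d : ℝ)) := by
    rw [pt, AddCircle.toCircle_apply_mk, Circle.coe_exp]
    congr 1; push_cast; ring
  have harg : |Real.pi * d| = Real.pi * |d| := by rw [abs_mul, abs_of_pos Real.pi_pos]
  have hd2 : |d| ≤ 1 / 2 := hd ▸ norm_le_half _
  have hsin : 2 / Real.pi * |Real.pi * d| ≤ |Real.sin (Real.pi * d)| :=
    Real.mul_abs_le_abs_sin (by rw [harg]; nlinarith [Real.pi_pos])
  calc 4 * ‖(d : UnitAddCircle)‖ = 2 * (2 / Real.pi * |Real.pi * d|) := by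
        rw [harg, hd]; field_simp; ring
    _ ≤ 2 * |Real.sin (Real.pi * d)| := by gcongr
    _ = ‖pt d - 1‖ := by
        rw [hpt, Complex.norm_exp_I_mul_ofReal_sub_one, norm_mul, Real.norm_eq_abs,
          Real.norm_eq_abs, abs_two]
        congr 3; ring

end Circle

section SzegoError

lemma szegoError_nonneg (ρ : Measure UnitAddCircle) (n : ℕ) : 0 ≤ szegoError ρ n :=
  Real.iInf_nonneg fun _ => Real.sqrt_nonneg _

lemma szegoError_natDegree_le_of_monic (ρ : Measure UnitAddCircle) {p : ℂ[X]} (hp : p.Monic) :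
    szegoError ρ p.natDegree ≤ √(∫ θ, ‖p.eval (pt θ)‖ ^ 2 ∂ρ) := by
  have hbdd : BddBelow (range fun q : Fin p.natDegree → ℂ =>
      √(∫ θ, ‖(∑ j, q j * pt θ ^ (j : ℕ)) + pt θ ^ p.natDegree‖ ^ 2 ∂ρ)) :=
    ⟨0, by rintro _ ⟨q, rfl⟩; positivity⟩
  refine (ciInf_le hbdd fun j => p.coeff j).trans_eq ?_
  have heval (z : ℂ) : (∑ j : Fin p.natDegree, p.coeff j * z ^ (j : ℕ)) + z ^ p.natDegree =
      p.eval z := by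
    rw [Fin.sum_univ_eq_sum_range (fun j => p.coeff j * z ^ j), eval_eq_sum_range,
      Finset.sum_range_succ, hp.coeff_natDegree, one_mul]
  simp only [heval]

lemma norm_eval_reflect_map_conj {p : ℂ[X]} {n : ℕ} (hn : p.natDegree ≤ n) {z : ℂ}
    (hz : ‖z‖ = 1) : ‖((p.map (starRingEnd ℂ)).reflect n).eval z‖ = ‖p.eval z‖ := by
  have hz0 : conj z ≠ 0 := by
    rw [← norm_ne_zero_iff, RCLike.norm_conj, hz]; exact one_ne_zero
  let := invertibleOfNonzero hz0
  have hinv : ⅟(conj z) = z := by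
    rw [invOf_eq_inv, ← map_inv₀, Complex.inv_eq_conj hz, Complex.conj_conj]
  have h := eval₂_reflect_mul_pow (RingHom.id ℂ) (conj z) n (p.map (starRingEnd ℂ))
    (natDegree_map_le.trans hn)
  rw [hinv, ← eval, ← eval, eval_map, eval₂_hom] at h
  rw [← RCLike.norm_conj (p.eval z), ← h, norm_mul, norm_pow, RCLike.norm_conj, hz, one_pow,
    mul_one]

/-- The reversed polynomial `t ^ n * conj (p t)` has leading coefficient `conj (p 0)`, so the
extremal problem may be normalized at the origin instead of at infinity. -/
lemma szegoError_le_div_norm_coeff_zero (ρ : Measure UnitAddCircle) {p : ℂ[X]}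
    (h0 : p.coeff 0 ≠ 0) {n : ℕ} (hn : p.natDegree ≤ n) :
    szegoError ρ n ≤ √(∫ θ, ‖p.eval (pt θ)‖ ^ 2 ∂ρ) / ‖p.coeff 0‖ := by
  set r : ℂ[X] := (p.map (starRingEnd ℂ)).reflect n with hr
  have hrn : r.coeff n = conj (p.coeff 0) := by
    rw [hr, coeff_reflect, revAt_le le_rfl, Nat.sub_self, coeff_map]
  have hr0 : r.coeff n ≠ 0 := by rwa [hrn, _root_.map_ne_zero]
  have hdeg : r.natDegree = n := by
    refine le_antisymm (natDegree_reflect_le.trans ?_) (le_natDegree_of_ne_zero hr0)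
    exact max_le le_rfl (natDegree_map_le.trans hn)
  have hlead : r.leadingCoeff = conj (p.coeff 0) := by rw [leadingCoeff, hdeg, hrn]
  have hr_ne : r ≠ 0 := by rintro h; simp [h] at hr0
  have hmonic := monic_mul_leadingCoeff_inv hr_ne
  have h := szegoError_natDegree_le_of_monic ρ hmonic
  rw [natDegree_mul_leadingCoeff_inv r hr_ne, hdeg, hlead] at h
  refine h.trans_eq ?_
  simp only [eval_mul, eval_C, norm_mul, norm_inv, RCLike.norm_conj, mul_pow, hr,
    norm_eval_reflect_map_conj hn (norm_pt _)]
  rw [integral_mul_const, Real.sqrt_mul' _ (by positivity), Real.sqrt_sq (by positivity),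
    div_eq_mul_inv]

end SzegoError

section TruncatedExponential

open PowerSeries (trunc)

lemma pow_div_factorial_le_half_pow {x : ℝ} (hx : 0 ≤ x) {m : ℕ} (hm : 6 * x ≤ m) :
    x ^ m / m.factorial ≤ (1 / 2) ^ m :=
  calc x ^ m / m.factorial ≤ ((m : ℝ) / 6) ^ m / m.factorial := by gcongr; linarith
    _ = (1 / 6) ^ m * ((m : ℝ) ^ m / m.factorial) := by rw [div_pow, one_div_pow]; ring
    _ ≤ (1 / 6) ^ m * Real.exp m := by gcongr; exact Real.pow_div_factorial_le_exp _ (by simp) m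
    _ = (1 / 6 * Real.exp 1) ^ m := by rw [mul_pow, ← Real.exp_nat_mul, mul_one]
    _ ≤ (1 / 2) ^ m := by gcongr; linarith [Real.exp_one_lt_three]

lemma norm_exp_sub_eval_trunc_exp_le {z : ℂ} {m : ℕ} (hm : 6 * ‖z‖ ≤ m) :
    ‖Complex.exp z - (trunc m (PowerSeries.exp ℂ)).eval z‖ ≤ 2 * (1 / 2) ^ m := by
  have hsum : (trunc m (PowerSeries.exp ℂ)).eval z =
      ∑ j ∈ Finset.range m, z ^ j / (j.factorial : ℂ) := by
    rw [eval, PowerSeries.eval₂_trunc_eq_sum_range]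
    refine Finset.sum_congr rfl fun j _ => ?_
    rw [PowerSeries.coeff_exp]
    simp [div_eq_inv_mul]
  have hratio : ‖z‖ / (m.succ : ℝ) ≤ 1 / 2 := by
    rw [div_le_iff₀ (by positivity)]
    push_cast
    linarith [norm_nonneg z]
  rw [hsum, mul_comm]
  refine (Complex.exp_bound' hratio).trans ?_
  gcongr
  exact pow_div_factorial_le_half_pow (norm_nonneg z) hm

lemma exists_natDegree_le_norm_exp_eval_sub_le (q : ℂ[X]) {m : ℕ} (hm : 2 ≤ m) :
    ∃ p : ℂ[X], p.natDegree ≤ m * q.natDegree ∧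
      ∀ z, 6 * ‖q.eval z‖ ≤ m → ‖Complex.exp (q.eval z) - p.eval z‖ ≤ 1 / 2 := by
  refine ⟨(trunc m (PowerSeries.exp ℂ)).comp q, ?_, fun z hz => ?_⟩
  · obtain ⟨k, rfl⟩ := Nat.exists_eq_add_of_le' (one_le_two.trans hm)
    rw [natDegree_comp]
    gcongr
    exact (PowerSeries.natDegree_trunc_lt _ k).le
  · have hpow : (1 / 2 : ℝ) ^ m ≤ (1 / 2) ^ 2 :=
      pow_le_pow_of_le_one (by norm_num) (by norm_num) hm
    rw [eval_comp]
    linarith [norm_exp_sub_eval_trunc_exp_le hz]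

/-- The test polynomial is a truncated exponential of `q`. -/
lemma szegoError_le_of_re_le (ρ : Measure UnitAddCircle) {q : ℂ[X]} {m n : ℕ} (hm : 2 ≤ m)
    (hn : m * q.natDegree ≤ n) (hq : ∀ z, ‖z‖ ≤ 1 → 6 * ‖q.eval z‖ ≤ m)
    (hq0 : 0 ≤ (q.eval 0).re) {g : UnitAddCircle → ℝ} (hg0 : ∀ θ, 0 ≤ g θ)
    (hg : ∀ θ, (q.eval (pt θ)).re ≤ g θ) (hint : Integrable (fun θ => Real.exp (2 * g θ)) ρ) :
    szegoError ρ n ≤ 4 * √(∫ θ, Real.exp (2 * g θ) ∂ρ) * Real.exp (-(q.eval 0).re) := by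
  obtain ⟨p, hdeg, happrox⟩ := exists_natDegree_le_norm_exp_eval_sub_le q hm
  have hcircle (θ : UnitAddCircle) : ‖p.eval (pt θ)‖ ≤ 2 * Real.exp (g θ) := by
    have hexp : ‖Complex.exp (q.eval (pt θ))‖ ≤ Real.exp (g θ) := by
      rw [Complex.norm_exp]; exact Real.exp_le_exp.2 (hg θ)
    have htri := norm_sub_norm_le (p.eval (pt θ)) (Complex.exp (q.eval (pt θ)))
    rw [norm_sub_rev] at htri
    linarith [happrox _ (hq _ (norm_pt θ).le), Real.one_le_exp (hg0 θ)]
  have hsq (θ : UnitAddCircle) : ‖p.eval (pt θ)‖ ^ 2 ≤ 2 ^ 2 * Real.exp (2 * g θ) := by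
    refine (pow_le_pow_left₀ (norm_nonneg _) (hcircle θ) 2).trans_eq ?_
    rw [mul_pow, ← Real.exp_nat_mul, Nat.cast_ofNat]
  have hsqrt : √(∫ θ, ‖p.eval (pt θ)‖ ^ 2 ∂ρ) ≤ 2 * √(∫ θ, Real.exp (2 * g θ) ∂ρ) :=
    calc √(∫ θ, ‖p.eval (pt θ)‖ ^ 2 ∂ρ) ≤ √(2 ^ 2 * ∫ θ, Real.exp (2 * g θ) ∂ρ) := by
          rw [← integral_const_mul]
          exact Real.sqrt_le_sqrt (integral_mono_of_nonneg (.of_forall fun _ => by positivity)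
            (hint.const_mul _) (.of_forall hsq))
      _ = 2 * √(∫ θ, Real.exp (2 * g θ) ∂ρ) := by
          rw [Real.sqrt_mul (by positivity), Real.sqrt_sq zero_le_two]
  have horigin : Real.exp (q.eval 0).re / 2 ≤ ‖p.coeff 0‖ := by
    have htri := norm_sub_norm_le (Complex.exp (q.eval 0)) (p.eval 0)
    rw [Complex.norm_exp] at htri
    rw [coeff_zero_eq_eval_zero]
    linarith [happrox 0 (hq 0 (by simp)), Real.one_le_exp hq0]
  have hpos : 0 < ‖p.coeff 0‖ := lt_of_lt_of_le (by positivity) horigin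
  calc szegoError ρ n ≤ √(∫ θ, ‖p.eval (pt θ)‖ ^ 2 ∂ρ) / ‖p.coeff 0‖ :=
        szegoError_le_div_norm_coeff_zero ρ (norm_pos_iff.1 hpos) (hdeg.trans hn)
    _ ≤ 2 * √(∫ θ, Real.exp (2 * g θ) ∂ρ) / (Real.exp (q.eval 0).re / 2) := by gcongr
    _ = 4 * √(∫ θ, Real.exp (2 * g θ) ∂ρ) * Real.exp (-(q.eval 0).re) := by
        rw [Real.exp_neg]; field_simp; ring

end TruncatedExponential

section Convolution

lemma integrable_of_continuous {f : UnitAddCircle → ℂ} (hf : Continuous f) :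
    Integrable f haarAddCircle :=
  hf.integrable_of_hasCompactSupport (.of_compactSpace f)

lemma integral_eval_pt (K : ℂ[X]) : ∫ s, K.eval (pt s) ∂haarAddCircle = K.coeff 0 := by
  simp only [eval_eq_sum_range]
  rw [integral_finsetSum _ (f := fun k s => K.coeff k * pt s ^ k) fun k _ =>
    integrable_of_continuous (continuous_const.mul (continuous_pt.pow k))]
  simp only [integral_const_mul, integral_pt_pow, ← eval_eq_sum_range, ← coeff_zero_eq_eval_zero]

lemma integrable_continuous_mul {g f : UnitAddCircle → ℂ} (hg : Continuous g)
    (hf : Integrable f haarAddCircle) : Integrable (fun s => g s * f s) haarAddCircle := by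
  obtain ⟨B, hB⟩ := isCompact_univ.exists_bound_of_continuousOn hg.continuousOn
  exact hf.bdd_mul hg.aestronglyMeasurable (.of_forall fun s => hB s (mem_univ s))

lemma continuous_mul_conj_pt (z : ℂ) : Continuous fun s => z * conj (pt s) :=
  continuous_const.mul (Complex.continuous_conj.comp continuous_pt)

lemma integrable_eval_mul (K : ℂ[X]) {f : UnitAddCircle → ℂ} (hf : Integrable f haarAddCircle)
    (z : ℂ) : Integrable (fun s => K.eval (z * conj (pt s)) * f s) haarAddCircle :=
  integrable_continuous_mul (K.continuous.comp (continuous_mul_conj_pt z)) hf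

/-- The convolution `z ↦ ∫ K (z * conj t) f(t) dm(t)` of a function on the circle with an analytic
polynomial `K`, as a polynomial in `z`. -/
noncomputable def polyConvolution (K : ℂ[X]) (f : UnitAddCircle → ℂ) : ℂ[X] :=
  ∑ k ∈ Finset.range (K.natDegree + 1), C (K.coeff k * fourierCoeff f k) * X ^ k

lemma natDegree_polyConvolution_le (K : ℂ[X]) (f : UnitAddCircle → ℂ) :
    (polyConvolution K f).natDegree ≤ K.natDegree :=
  natDegree_sum_le_of_forall_le _ _ fun _ hk =>
    (natDegree_C_mul_X_pow_le _ _).trans (Finset.mem_range_succ_iff.1 hk)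

lemma fourierCoeff_natCast (f : UnitAddCircle → ℂ) (k : ℕ) :
    fourierCoeff f k = ∫ s, conj (pt s) ^ k * f s ∂haarAddCircle := by
  simp only [fourierCoeff, smul_eq_mul, fourier_neg]
  simp only [fourier_apply, natCast_zsmul, AddCircle.toCircle_nsmul, Circle.coe_pow, map_pow, pt]

variable {f : UnitAddCircle → ℂ} {h : UnitAddCircle → ℝ} {K : ℂ[X]}

lemma eval_polyConvolution (K : ℂ[X]) (hf : Integrable f haarAddCircle) (z : ℂ) :
    (polyConvolution K f).eval z = ∫ s, K.eval (z * conj (pt s)) * f s ∂haarAddCircle := by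
  have hint (k : ℕ) : Integrable (fun s => K.coeff k * (z * conj (pt s)) ^ k * f s)
      haarAddCircle :=
    integrable_continuous_mul (continuous_const.mul ((continuous_mul_conj_pt z).pow k)) hf
  simp only [eval_eq_sum_range (p := K), Finset.sum_mul]
  rw [integral_finsetSum _ fun k _ => hint k, polyConvolution, eval_finsetSum]
  refine Finset.sum_congr rfl fun k _ => ?_
  simp only [eval_mul, eval_C, eval_pow, eval_X, mul_pow, fourierCoeff_natCast]
  rw [mul_assoc, mul_comm _ (z ^ k), ← integral_const_mul, ← integral_const_mul]
  exact integral_congr_ae (.of_forall fun s => by ring)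

lemma eval_zero_polyConvolution (K : ℂ[X]) (hf : Integrable f haarAddCircle) :
    (polyConvolution K f).eval 0 = K.coeff 0 * ∫ s, f s ∂haarAddCircle := by
  simp only [eval_polyConvolution K hf, zero_mul, ← coeff_zero_eq_eval_zero, integral_const_mul]

lemma norm_eval_polyConvolution_le {B M : ℝ} (hK : ∀ z, ‖z‖ ≤ 1 → ‖K.eval z‖ ≤ B)
    (hf : Integrable f haarAddCircle) (hM : ∀ s, ‖f s‖ ≤ M) {z : ℂ} (hz : ‖z‖ ≤ 1) :
    ‖(polyConvolution K f).eval z‖ ≤ B * M := by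
  have hbound (s : UnitAddCircle) : ‖K.eval (z * conj (pt s)) * f s‖ ≤ B * M := by
    have hKs := hK (z * conj (pt s)) (by rwa [norm_mul_conj_pt])
    rw [norm_mul]
    exact mul_le_mul hKs (hM s) (norm_nonneg _) ((norm_nonneg _).trans hKs)
  rw [eval_polyConvolution K hf]
  simpa using norm_integral_le_of_norm_le_const (μ := haarAddCircle) (.of_forall hbound)

lemma re_eval_polyConvolution (K : ℂ[X]) (hh : Integrable h haarAddCircle) (x : UnitAddCircle) :
    ((polyConvolution K fun s => (h s : ℂ)).eval (pt x)).re =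
      ∫ s, (K.eval (pt (x - s))).re * h s ∂haarAddCircle := by
  have hhC : Integrable (fun s => (h s : ℂ)) haarAddCircle := hh.ofReal
  rw [eval_polyConvolution K hhC]
  refine (integral_re (integrable_eval_mul K hhC (pt x))).symm.trans ?_
  simp only [RCLike.re_eq_complex_re, Complex.re_mul_ofReal, pt_sub]

lemma integral_re_eval_pt_sub (hK : K.coeff 0 = 1) (x : UnitAddCircle) :
    ∫ s, (K.eval (pt (x - s))).re ∂haarAddCircle = 1 := by
  rw [integral_sub_left_eq_self fun s => (K.eval (pt s)).re]
  have hint : Integrable (fun s => K.eval (pt s)) haarAddCircle :=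
    integrable_of_continuous (K.continuous.comp continuous_pt)
  refine (integral_re hint).trans ?_
  rw [integral_eval_pt, hK, RCLike.one_re]

lemma re_eval_polyConvolution_le {η δ : ℝ} (hK0 : K.coeff 0 = 1)
    (hKpos : ∀ θ, 0 ≤ (K.eval (pt θ)).re) (hδ : 0 ≤ δ)
    (hKδ : ∀ θ, η < ‖θ‖ → (K.eval (pt θ)).re ≤ δ)
    (hh : Integrable h haarAddCircle) (h0 : ∀ s, 0 ≤ h s) {M : ℝ} (hM : ∀ s, h s ≤ M)
    {x : UnitAddCircle} {B : ℝ} (hB : 0 ≤ B) (hx : ∀ y, ‖x - y‖ ≤ η → h y ≤ B) :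
    ((polyConvolution K fun s => (h s : ℂ)).eval (pt x)).re ≤ B + δ * M := by
  have hM0 : 0 ≤ M := (h0 0).trans (hM 0)
  have hKint : Integrable (fun s => (K.eval (pt (x - s))).re) haarAddCircle :=
    (integrable_of_continuous (K.continuous.comp (continuous_pt.comp (by fun_prop)))).re
  have hKh : Integrable (fun s => (K.eval (pt (x - s))).re * h s) haarAddCircle := by
    have hhC : Integrable (fun s => (h s : ℂ)) haarAddCircle := hh.ofReal
    simpa only [RCLike.re_eq_complex_re, Complex.re_mul_ofReal, pt_sub] using
      (integrable_eval_mul K hhC (pt x)).re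
  have hpointwise (s : UnitAddCircle) :
      (K.eval (pt (x - s))).re * h s ≤ (K.eval (pt (x - s))).re * B + δ * M := by
    have hKs := hKpos (x - s)
    rcases le_or_gt ‖x - s‖ η with hnear | hfar
    · exact (mul_le_mul_of_nonneg_left (hx s hnear) hKs).trans
        (le_add_of_nonneg_right (by positivity))
    · exact (mul_le_mul (hKδ _ hfar) (hM s) (h0 s) hδ).trans
        (le_add_of_nonneg_left (by positivity))
  calc ((polyConvolution K fun s => (h s : ℂ)).eval (pt x)).re
      = ∫ s, (K.eval (pt (x - s))).re * h s ∂haarAddCircle := re_eval_polyConvolution K hh x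
    _ ≤ ∫ s, ((K.eval (pt (x - s))).re * B + δ * M) ∂haarAddCircle :=
        integral_mono hKh ((hKint.mul_const B).add (integrable_const _)) hpointwise
    _ = B + δ * M := by
        rw [integral_add (hKint.mul_const B) (integrable_const _), integral_mul_const,
          integral_re_eval_pt_sub hK0]
        simp

end Convolution

section FejerKernel

/-- The analytic polynomial whose real part on the unit circle is the Fejér kernel of order `N`. -/
noncomputable def fejer (N : ℕ) : ℂ[X] :=
  C ((N : ℂ)⁻¹) * ∑ i ∈ Finset.range N, ∑ j ∈ Finset.range N, X ^ (i.dist j)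

lemma eval_fejer (N : ℕ) (z : ℂ) :
    (fejer N).eval z =
      (N : ℂ)⁻¹ * ∑ i ∈ Finset.range N, ∑ j ∈ Finset.range N, z ^ (i.dist j) := by
  simp only [fejer, eval_mul, eval_C, eval_finsetSum, eval_pow, eval_X]

lemma natDegree_fejer_le (N : ℕ) : (fejer N).natDegree ≤ N := by
  refine (natDegree_C_mul_le _ _).trans <| natDegree_sum_le_of_forall_le _ _ fun i hi =>
    natDegree_sum_le_of_forall_le _ _ fun j hj => (natDegree_X_pow_le _).trans ?_
  rw [Finset.mem_range] at hi hj
  unfold Nat.dist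
  omega

lemma coeff_zero_fejer {N : ℕ} (hN : N ≠ 0) : (fejer N).coeff 0 = 1 := by
  have hrow (i : ℕ) (hi : i ∈ Finset.range N) :
      ∑ j ∈ Finset.range N, (0 : ℂ) ^ (i.dist j) = 1 := by
    rw [Finset.sum_eq_single_of_mem i hi fun j _ hj =>
      zero_pow fun h => hj (Nat.eq_of_dist_eq_zero h).symm, Nat.dist_self, pow_zero]
  rw [coeff_zero_eq_eval_zero, eval_fejer, Finset.sum_congr rfl hrow]
  simp [hN]

lemma norm_eval_fejer_le (N : ℕ) {z : ℂ} (hz : ‖z‖ ≤ 1) : ‖(fejer N).eval z‖ ≤ N := by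
  have hsum : ‖∑ i ∈ Finset.range N, ∑ j ∈ Finset.range N, z ^ (i.dist j)‖ ≤ N * N := by
    calc ‖∑ i ∈ Finset.range N, ∑ j ∈ Finset.range N, z ^ (i.dist j)‖
        ≤ ∑ _i ∈ Finset.range N, ∑ _j ∈ Finset.range N, (1 : ℝ) :=
          norm_sum_le_of_le _ fun i _ => norm_sum_le_of_le _ fun j _ => by
            rw [norm_pow]; exact pow_le_one₀ (norm_nonneg _) hz
      _ = N * N := by simp
  rw [eval_fejer, norm_mul, norm_inv, Complex.norm_natCast]
  exact (mul_le_mul_of_nonneg_left hsum (by positivity)).trans_eq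
    (by rw [← mul_assoc, inv_mul_mul_self])

lemma re_pow_dist {z : ℂ} (hz : ‖z‖ = 1) (i j : ℕ) :
    (z ^ (i.dist j)).re = (z ^ i * conj (z ^ j)).re := by
  have hunit (k : ℕ) : z ^ k * conj (z ^ k) = 1 := by
    rw [Complex.mul_conj', norm_pow, hz]; simp
  rcases le_total j i with h | h
  · obtain ⟨d, rfl⟩ := Nat.exists_eq_add_of_le' h
    rw [Nat.dist_eq_sub_of_le_right h, Nat.add_sub_cancel, pow_add, mul_assoc, hunit, mul_one]
  · obtain ⟨d, rfl⟩ := Nat.exists_eq_add_of_le' h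
    rw [Nat.dist_eq_sub_of_le h, Nat.add_sub_cancel, pow_add, map_mul, mul_left_comm, hunit,
      mul_one, Complex.conj_re]

lemma re_eval_fejer (N : ℕ) {z : ℂ} (hz : ‖z‖ = 1) :
    ((fejer N).eval z).re = ‖∑ i ∈ Finset.range N, z ^ i‖ ^ 2 / N := by
  have hsq : ‖∑ i ∈ Finset.range N, z ^ i‖ ^ 2 =
      ∑ i ∈ Finset.range N, ∑ j ∈ Finset.range N, (z ^ i * conj (z ^ j)).re := by
    rw [← Complex.ofReal_re (‖_‖ ^ 2), Complex.ofReal_pow, ← Complex.mul_conj', map_sum,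
      Finset.sum_mul_sum]
    simp only [Complex.re_sum]
  rw [eval_fejer, ← Complex.ofReal_natCast, ← Complex.ofReal_inv, Complex.re_ofReal_mul, hsq,
    inv_mul_eq_div]
  simp only [Complex.re_sum, re_pow_dist hz]

lemma re_eval_fejer_nonneg (N : ℕ) {z : ℂ} (hz : ‖z‖ = 1) : 0 ≤ ((fejer N).eval z).re := by
  rw [re_eval_fejer N hz]; positivity

lemma re_eval_fejer_le (N : ℕ) {z : ℂ} (hz : ‖z‖ = 1) (hz1 : z ≠ 1) :
    ((fejer N).eval z).re ≤ (2 / ‖z - 1‖) ^ 2 / N := by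
  have hpos : 0 < ‖z - 1‖ := norm_pos_iff.2 (sub_ne_zero.2 hz1)
  rw [re_eval_fejer N hz]
  gcongr
  rw [le_div_iff₀ hpos, ← norm_mul, geom_sum_mul]
  calc ‖z ^ N - 1‖ ≤ ‖z ^ N‖ + ‖(1 : ℂ)‖ := norm_sub_le _ _
    _ = 2 := by rw [norm_pow, hz]; norm_num

lemma re_eval_fejer_pt_le (N : ℕ) {η : ℝ} (hη : 0 < η) {θ : UnitAddCircle} (hθ : η ≤ ‖θ‖) :
    ((fejer N).eval (pt θ)).re ≤ 1 / (4 * η ^ 2 * N) := by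
  have hchord : 4 * η ≤ ‖pt θ - 1‖ := by linarith [four_mul_norm_le_norm_pt_sub_one θ]
  have hne : pt θ ≠ 1 := by
    rw [← sub_ne_zero, ← norm_pos_iff]; linarith
  calc ((fejer N).eval (pt θ)).re ≤ (2 / ‖pt θ - 1‖) ^ 2 / N := re_eval_fejer_le N (norm_pt θ) hne
    _ ≤ (2 / (4 * η)) ^ 2 / N := by gcongr
    _ = 1 / (4 * η ^ 2 * N) := by field_simp; norm_num

/-- The analytic polynomial whose real part on the unit circle is the Fejér mean of order `N` of
the real function `h`. -/
noncomputable def fejerMean (N : ℕ) (h : UnitAddCircle → ℝ) : ℂ[X] :=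
  polyConvolution (fejer N) fun s => (h s : ℂ)

lemma natDegree_fejerMean_le (N : ℕ) (h : UnitAddCircle → ℝ) : (fejerMean N h).natDegree ≤ N :=
  (natDegree_polyConvolution_le _ _).trans (natDegree_fejer_le N)

variable {h : UnitAddCircle → ℝ} {N : ℕ}

lemma eval_zero_fejerMean (hN : N ≠ 0) (hh : Integrable h haarAddCircle) :
    (fejerMean N h).eval 0 = ((∫ s, h s ∂haarAddCircle : ℝ) : ℂ) := by
  have hhC : Integrable (fun s => (h s : ℂ)) haarAddCircle := hh.ofReal
  rw [fejerMean, eval_zero_polyConvolution _ hhC, coeff_zero_fejer hN, one_mul]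
  exact integral_ofReal

lemma norm_eval_fejerMean_le (hh : Integrable h haarAddCircle) {M : ℝ} (hM : ∀ s, |h s| ≤ M)
    {z : ℂ} (hz : ‖z‖ ≤ 1) : ‖(fejerMean N h).eval z‖ ≤ N * M := by
  have hhC : Integrable (fun s => (h s : ℂ)) haarAddCircle := hh.ofReal
  exact norm_eval_polyConvolution_le (fun z => norm_eval_fejer_le N) hhC
    (fun s => (Complex.norm_real _).trans_le (hM s)) hz

lemma re_eval_fejerMean_le (hN : N ≠ 0) (hh : Integrable h haarAddCircle) (h0 : ∀ s, 0 ≤ h s)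
    {η : ℝ} (hη : 0 < η) (hM : ∀ s, h s ≤ 4 * η ^ 2 * N) {x : UnitAddCircle} {B : ℝ} (hB : 0 ≤ B)
    (hx : ∀ y, ‖x - y‖ ≤ η → h y ≤ B) : ((fejerMean N h).eval (pt x)).re ≤ B + 1 := by
  have hle := re_eval_polyConvolution_le (coeff_zero_fejer hN)
    (fun θ => re_eval_fejer_nonneg N (norm_pt θ)) (by positivity)
    (fun θ hθ => re_eval_fejer_pt_le N hη hθ.le) hh h0 hM hB hx
  rwa [one_div_mul_cancel (by positivity)] at hle

end FejerKernel

section LocallyComparable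

variable {h : UnitAddCircle → ℝ} {D η : ℝ} {N : ℕ}

/-- The polynomial is the Fejér mean of `h / (2 * D)`. -/
lemma exists_natDegree_le_re_eval_pt_le (hm : Measurable h) (h0 : ∀ s, 0 ≤ h s) (hD : 1 ≤ D)
    (hη : 0 < η) (hloc : ∀ x y, ‖x - y‖ ≤ η → h y ≤ D * h x) (hN : N ≠ 0) (hhN : ∀ s, h s ≤ N)
    (hhη : ∀ s, h s ≤ 4 * η ^ 2 * N) :
    ∃ q : ℂ[X], q.natDegree ≤ N ∧ (∀ z, ‖z‖ ≤ 1 → ‖q.eval z‖ ≤ (N : ℝ) ^ 2 / 2) ∧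
      (q.eval 0).re = (∫ s, h s ∂haarAddCircle) / (2 * D) ∧
      ∀ x, (q.eval (pt x)).re ≤ (1 + h x) / 2 := by
  have habs (s : UnitAddCircle) : |h s| ≤ N := by rw [abs_of_nonneg (h0 s)]; exact hhN s
  have hh : Integrable h haarAddCircle := .of_bound hm.aestronglyMeasurable N (.of_forall habs)
  set κ : ℝ := 1 / (2 * D) with hκ
  have hκ0 : 0 < κ := by positivity
  have hκ1 : κ ≤ 1 / 2 := one_div_le_one_div_of_le two_pos (by linarith)
  refine ⟨C (κ : ℂ) * fejerMean N h, (natDegree_C_mul_le _ _).trans (natDegree_fejerMean_le N h),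
    fun z hz => ?_, ?_, fun x => ?_⟩ <;> rw [eval_mul, eval_C]
  · have hmean : ‖(fejerMean N h).eval z‖ ≤ N * N := norm_eval_fejerMean_le hh habs hz
    rw [norm_mul, Complex.norm_real, Real.norm_of_nonneg hκ0.le]
    calc κ * ‖(fejerMean N h).eval z‖ ≤ 1 / 2 * (N * N) := by gcongr
      _ = (N : ℝ) ^ 2 / 2 := by ring
  · rw [eval_zero_fejerMean hN hh, Complex.re_ofReal_mul, Complex.ofReal_re, hκ,
      one_div_mul_eq_div]
  · have hmean : ((fejerMean N h).eval (pt x)).re ≤ D * h x + 1 :=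
      re_eval_fejerMean_le hN hh h0 hη hhη (mul_nonneg (by linarith) (h0 x)) (hloc x)
    rw [Complex.re_ofReal_mul]
    calc κ * ((fejerMean N h).eval (pt x)).re ≤ κ * (D * h x + 1) := by gcongr
      _ = h x / 2 + κ := by rw [hκ]; field_simp
      _ ≤ (1 + h x) / 2 := by linarith

lemma szegoError_le_of_locally_le_mul {ρ : Measure UnitAddCircle} (hm : Measurable h)
    (h0 : ∀ s, 0 ≤ h s) (hint : Integrable (fun θ => Real.exp (h θ)) ρ) (hD : 1 ≤ D) (hη : 0 < η)
    (hloc : ∀ x y, ‖x - y‖ ≤ η → h y ≤ D * h x) (hN : N ≠ 0) (hhN : ∀ s, h s ≤ N)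
    (hhη : ∀ s, h s ≤ 4 * η ^ 2 * N) {n : ℕ} (hn : 3 * N ^ 3 ≤ n) :
    szegoError ρ n ≤ 4 * √(Real.exp 1 * ∫ θ, Real.exp (h θ) ∂ρ) *
      Real.exp (-((∫ s, h s ∂haarAddCircle) / (2 * D))) := by
  obtain ⟨q, hdeg, hnorm, horigin, hre⟩ :=
    exists_natDegree_le_re_eval_pt_le hm h0 hD hη hloc hN hhN hhη
  have hmn : 3 * N ^ 2 * q.natDegree ≤ n :=
    calc 3 * N ^ 2 * q.natDegree ≤ 3 * N ^ 2 * N := by gcongr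
      _ ≤ n := by rwa [mul_assoc, ← pow_succ]
  have hm2 : 2 ≤ 3 * N ^ 2 := by nlinarith [Nat.pos_of_ne_zero hN]
  have hexp (θ : UnitAddCircle) :
      Real.exp (2 * ((1 + h θ) / 2)) = Real.exp 1 * Real.exp (h θ) := by
    rw [← Real.exp_add]; congr 1; ring
  have hkey := szegoError_le_of_re_le ρ hm2 hmn
    (fun z hz => by push_cast; linarith [hnorm z hz])
    (horigin ▸ div_nonneg (integral_nonneg h0) (by linarith))
    (g := fun θ => (1 + h θ) / 2) (fun θ => by linarith [h0 θ]) hre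
    (by simpa only [hexp] using hint.const_mul _)
  simpa only [hexp, integral_const_mul, horigin] using hkey

end LocallyComparable

section Truncation

/-- The truncation of `H` at the level `a`, as a real function. -/
noncomputable def trunc (H : UnitAddCircle → ℝ≥0∞) (a : ℝ) (x : UnitAddCircle) : ℝ :=
  (min (H x) (ENNReal.ofReal a)).toReal

variable {H : UnitAddCircle → ℝ≥0∞} {a : ℝ}

lemma trunc_nonneg (H : UnitAddCircle → ℝ≥0∞) (a : ℝ) (x : UnitAddCircle) : 0 ≤ trunc H a x :=
  ENNReal.toReal_nonneg

lemma trunc_le (H : UnitAddCircle → ℝ≥0∞) (ha : 0 ≤ a) (x : UnitAddCircle) : trunc H a x ≤ a :=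
  ENNReal.toReal_le_of_le_ofReal ha (min_le_right _ _)

lemma ofReal_trunc (H : UnitAddCircle → ℝ≥0∞) (a : ℝ) (x : UnitAddCircle) :
    ENNReal.ofReal (trunc H a x) = min (H x) (ENNReal.ofReal a) :=
  ENNReal.ofReal_toReal (min_lt_of_right_lt ENNReal.ofReal_lt_top).ne

lemma measurable_trunc (hH : Measurable H) (a : ℝ) : Measurable (trunc H a) :=
  (hH.min measurable_const).ennreal_toReal

lemma integrable_trunc {μ : Measure UnitAddCircle} [IsFiniteMeasure μ] (hH : Measurable H)
    (ha : 0 ≤ a) : Integrable (trunc H a) μ :=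
  .of_bound (measurable_trunc hH a).aestronglyMeasurable a (.of_forall fun x => by
    rw [Real.norm_of_nonneg (trunc_nonneg H a x)]; exact trunc_le H ha x)

lemma trunc_le_mul_trunc {D : ℝ≥0} (hD : 1 ≤ D) {x y : UnitAddCircle}
    (hxy : H x ≤ ENNReal.ofReal a → H y ≤ D * H x) : trunc H a y ≤ D * trunc H a x := by
  rw [← ENNReal.ofReal_le_ofReal_iff (mul_nonneg D.coe_nonneg (trunc_nonneg H a x)),
    ENNReal.ofReal_mul D.coe_nonneg, ofReal_trunc, ofReal_trunc, ENNReal.ofReal_coe_nnreal]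
  rcases le_total (H x) (ENNReal.ofReal a) with hx | hx
  · rw [min_eq_left hx]
    exact (min_le_left _ _).trans (hxy hx)
  · rw [min_eq_right hx]
    exact (min_le_right _ _).trans (le_mul_of_one_le_left zero_le (by exact_mod_cast hD))

lemma ofReal_exp_trunc_le (H : UnitAddCircle → ℝ≥0∞) (a : ℝ) (x : UnitAddCircle) :
    ENNReal.ofReal (Real.exp (trunc H a x)) ≤ EReal.exp (H x : EReal) := by
  rw [← EReal.exp_coe]
  refine EReal.exp_monotone ?_
  rw [← max_eq_left (trunc_nonneg H a x), ← EReal.coe_ennreal_ofReal, ofReal_trunc,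
    EReal.coe_ennreal_le_coe_ennreal_iff]
  exact min_le_left _ _

variable {ρ : Measure UnitAddCircle}

lemma lintegral_exp_trunc_le (H : UnitAddCircle → ℝ≥0∞) (a : ℝ) :
    ∫⁻ x, ENNReal.ofReal (Real.exp (trunc H a x)) ∂ρ ≤ ∫⁻ x, EReal.exp (H x : EReal) ∂ρ :=
  lintegral_mono (ofReal_exp_trunc_le H a)

lemma integrable_exp_trunc (hH : Measurable H) (hρ : ∫⁻ x, EReal.exp (H x : EReal) ∂ρ < ∞)
    (a : ℝ) : Integrable (fun x => Real.exp (trunc H a x)) ρ := by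
  refine ⟨(measurable_trunc hH a).exp.aestronglyMeasurable, ?_⟩
  rw [hasFiniteIntegral_iff_ofReal (.of_forall fun _ => (Real.exp_pos _).le)]
  exact (lintegral_exp_trunc_le H a).trans_lt hρ

lemma integral_exp_trunc_le (hH : Measurable H) (hρ : ∫⁻ x, EReal.exp (H x : EReal) ∂ρ < ∞)
    (a : ℝ) :
    ∫ x, Real.exp (trunc H a x) ∂ρ ≤ (∫⁻ x, EReal.exp (H x : EReal) ∂ρ).toReal := by
  rw [integral_eq_lintegral_of_nonneg_ae (.of_forall fun _ => (Real.exp_pos _).le)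
    (measurable_trunc hH a).exp.aestronglyMeasurable]
  exact ENNReal.toReal_mono hρ.ne (lintegral_exp_trunc_le H a)

lemma ofReal_integral_trunc (hH : Measurable H) (ha : 0 ≤ a) :
    ENNReal.ofReal (∫ x, trunc H a x ∂haarAddCircle) = ∫⁻ t in Ioo 0 a, distribution H t := by
  have hint : Integrable (trunc H a) haarAddCircle := integrable_trunc hH ha
  have hlevel (t : ℝ) (ht : t ∈ Ioi 0) : haarAddCircle {x | t < trunc H a x} =
      (Iio a).indicator (distribution H) t := by
    have hiff (x : UnitAddCircle) : t < trunc H a x ↔ ENNReal.ofReal t < H x ∧ t < a := by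
      rw [← ENNReal.ofReal_lt_ofReal_iff_of_nonneg (le_of_lt ht), ofReal_trunc, lt_min_iff,
        ENNReal.ofReal_lt_ofReal_iff_of_nonneg (le_of_lt ht)]
    by_cases hta : t < a <;> simp [hiff, hta, distribution]
  rw [ofReal_integral_eq_lintegral_ofReal hint (.of_forall (trunc_nonneg H a)),
    lintegral_eq_lintegral_meas_lt _ (.of_forall (trunc_nonneg H a)) hint.aemeasurable,
    setLIntegral_congr_fun measurableSet_Ioi hlevel, setLIntegral_indicator measurableSet_Iio,
    inter_comm, Ioi_inter_Iio]

lemma mul_log_le_integral_trunc (hH : Measurable H) {D a₀ : ℝ} (hD : 0 ≤ D) (ha₀ : 0 < a₀)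
    (hdist : ∀ t, a₀ ≤ t → ENNReal.ofReal D ≤ ENNReal.ofReal t * distribution H t)
    (ha : a₀ ≤ a) : D * Real.log (a / a₀) ≤ ∫ x, trunc H a x ∂haarAddCircle := by
  have hpos : 0 < a := ha₀.trans_le ha
  have hinv : IntegrableOn (fun t : ℝ => t⁻¹) (Ioo a₀ a) :=
    ((intervalIntegral.intervalIntegrable_inv (fun t ht => by
      rw [uIcc_of_le ha] at ht; exact (ha₀.trans_le ht.1).ne') continuousOn_id).1).mono_set
      Ioo_subset_Ioc_self
  have hlog : D * Real.log (a / a₀) = ∫ t in Ioo a₀ a, D * t⁻¹ := by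
    rw [integral_const_mul, ← integral_Ioc_eq_integral_Ioo, ← intervalIntegral.integral_of_le ha,
      integral_inv_of_pos ha₀ hpos]
  have hnonneg : ∀ᵐ t ∂volume.restrict (Ioo a₀ a), 0 ≤ D * t⁻¹ :=
    (ae_restrict_mem measurableSet_Ioo).mono fun t ht =>
      mul_nonneg hD (inv_nonneg.2 (ha₀.trans ht.1).le)
  rw [← ENNReal.ofReal_le_ofReal_iff (integral_nonneg (trunc_nonneg H a)),
    ofReal_integral_trunc hH hpos.le, hlog,
    ofReal_integral_eq_lintegral_ofReal (hinv.const_mul D) hnonneg]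
  calc ∫⁻ t in Ioo a₀ a, ENNReal.ofReal (D * t⁻¹) ≤ ∫⁻ t in Ioo a₀ a, distribution H t := by
        refine setLIntegral_mono' measurableSet_Ioo fun t ht => ?_
        rw [ENNReal.ofReal_mul hD, ENNReal.ofReal_inv_of_pos (ha₀.trans ht.1), ← div_eq_mul_inv]
        exact ENNReal.div_le_of_le_mul' (hdist t ht.1.le)
    _ ≤ ∫⁻ t in Ioo 0 a, distribution H t := lintegral_mono_set (Ioo_subset_Ioo_left ha₀.le)

end Truncation

section LocallyComparableTruncation

/-- The truncations of `H` at the high levels `a` vary by at most a constant factor over distances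
up to a power of `1 / a`. The upper bounds for `szegoError` use no other property of the shape of
`H`. -/
def HasLocallyComparableTrunc (H : UnitAddCircle → ℝ≥0∞) : Prop :=
  ∃ C : ℝ, 1 ≤ C ∧ ∃ k : ℕ, ∀ᶠ a : ℝ in atTop, ∀ x y : UnitAddCircle, ‖x - y‖ ≤ (a ^ k)⁻¹ →
    trunc H a y ≤ C * trunc H a x

variable {H : UnitAddCircle → ℝ≥0∞} {φ : ℝ → ℝ≥0∞}

lemma Regular.exists_doubling (hφ : Regular φ) :
    ∃ D : ℝ≥0, 1 ≤ D ∧ ∀ θ ∈ Ioc (0 : ℝ) (1 / 2), φ (θ / 2) ≤ D * φ θ := by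
  rcases hφ with ⟨hmono, -⟩ | ⟨⟨C, hC⟩, -⟩
  · refine ⟨2, one_le_two, fun θ hθ => ?_⟩
    have hhalf : 0 < θ / 2 := half_pos hθ.1
    have hle : ENNReal.ofReal (θ / 2) * φ (θ / 2) ≤ ENNReal.ofReal θ * φ θ :=
      hmono ⟨hhalf, by linarith [hθ.1, hθ.2]⟩ hθ (half_le_self hθ.1.le)
    have htwo : ENNReal.ofReal θ = ENNReal.ofReal (θ / 2) * 2 := by
      rw [← ENNReal.ofReal_ofNat 2, ← ENNReal.ofReal_mul hhalf.le, div_mul_cancel₀ θ two_ne_zero]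
    rw [htwo, mul_assoc] at hle
    exact (ENNReal.mul_le_mul_iff_right (by simpa using hhalf) ENNReal.ofReal_ne_top).1 hle
  · refine ⟨max C 1, le_max_right _ _, fun θ hθ => (hC θ hθ).trans ?_⟩
    gcongr
    exact le_max_left _ _

lemma IsMajorant.exists_eventually_inv_pow_le (hφ : IsMajorant φ)
    (hlog : ∃ c : ℝ, 0 < c ∧ ∀ᶠ θ : ℝ in 𝓝[>] 0,
      c * Real.log (1 / θ) ≤ Real.log (φ θ).toReal) :
    ∃ k : ℕ, ∀ᶠ a : ℝ in atTop, ∀ s ∈ Icc (0 : ℝ) (1 / 2), φ s ≤ ENNReal.ofReal a →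
      (a ^ k)⁻¹ ≤ s := by
  obtain ⟨c, hc, hev⟩ := hlog
  obtain ⟨ε, hε, hgrowth⟩ := mem_nhdsGT_iff_exists_Ioo_subset.1 hev
  obtain ⟨k, hk⟩ := exists_nat_gt c⁻¹
  have hk0 : k ≠ 0 := by
    rintro rfl
    exact (inv_pos.2 hc).not_gt (by simpa using hk)
  have hsmall : ∀ᶠ a : ℝ in atTop, (a ^ k)⁻¹ ≤ ε :=
    (tendsto_pow_atTop hk0).inv_tendsto_atTop.eventually (eventually_le_nhds hε)
  refine ⟨k, ?_⟩
  filter_upwards [hsmall, eventually_ge_atTop 1] with a haε ha s hs hφs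
  rcases le_or_gt ε s with hεs | hsε
  · exact haε.trans hεs
  have hs0 : 0 < s := hs.1.lt_of_ne' <| by
    rintro rfl
    exact ENNReal.ofReal_ne_top (top_le_iff.1 (hφ.map_zero ▸ hφs))
  have hφpos : 0 < (φ s).toReal :=
    ENNReal.toReal_pos (hφ.pos s hs).ne' (ne_top_of_le_ne_top ENNReal.ofReal_ne_top hφs)
  have hφa : (φ s).toReal ≤ a := ENNReal.toReal_le_of_le_ofReal (by linarith) hφs
  have hlog_le : Real.log s⁻¹ ≤ Real.log (a ^ k) :=
    calc Real.log s⁻¹ = c⁻¹ * (c * Real.log (1 / s)) := by field_simp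
      _ ≤ c⁻¹ * Real.log a := by
        gcongr
        exact (hgrowth ⟨hs0, hsε⟩).trans (Real.log_le_log hφpos hφa)
      _ ≤ k * Real.log a := by gcongr; exact Real.log_nonneg ha
      _ = Real.log (a ^ k) := (Real.log_pow a k).symm
  exact inv_le_of_inv_le₀ hs0 ((Real.log_le_log_iff (by positivity) (by positivity)).1 hlog_le)

namespace Subordinated

lemma exists_eq (hsub : Subordinated H φ) (x : UnitAddCircle) :
    ∃ s ∈ Icc (0 : ℝ) (1 / 2), φ s = H x :=
  intermediate_value_Icc' (by norm_num) hsub.majorant.continuousOn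
    ⟨hsub.le_inf.trans (iInf_le _ _), hsub.majorant.map_zero ▸ le_top⟩

lemma le_of_norm_sub_lt (hsub : Subordinated H φ) {s : ℝ} (hs : s ∈ Icc (0 : ℝ) (1 / 2))
    {x y : UnitAddCircle} (hφs : φ s = H x) (hxy : ‖x - y‖ < s) : H y ≤ φ (s - ‖x - y‖) := by
  obtain ⟨τ, rfl, hτ⟩ := exists_coe_eq_and_abs_eq_norm x
  obtain ⟨d, hd, hdnorm⟩ := exists_coe_eq_and_abs_eq_norm ((τ : UnitAddCircle) - y)
  have hy : ((τ - d : ℝ) : UnitAddCircle) = y := by rw [AddCircle.coe_sub, hd, sub_sub_cancel]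
  have hτI : τ ∈ Icc (-(1 / 2) : ℝ) (1 / 2) := abs_le.1 (hτ ▸ norm_le_half _)
  rw [← hdnorm] at hxy ⊢
  rw [← hy]
  rcases le_total 0 d with h0 | h0
  · rw [abs_of_nonneg h0] at hxy ⊢
    refine (hsub.left τ hτI s hs hφs (τ - d) (by linarith) (by linarith)).trans_eq ?_
    congr 1; ring
  · rw [abs_of_nonpos h0] at hxy ⊢
    refine (hsub.right τ hτI s hs hφs (τ - d) (by linarith) (by linarith)).trans_eq ?_
    congr 1; ring

lemma le_mul_of_norm_sub_le (hsub : Subordinated H φ) {D : ℝ≥0}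
    (hdbl : ∀ θ ∈ Ioc (0 : ℝ) (1 / 2), φ (θ / 2) ≤ D * φ θ) {s : ℝ}
    (hs : s ∈ Ioc (0 : ℝ) (1 / 2)) {x y : UnitAddCircle} (hφs : φ s = H x)
    (hxy : ‖x - y‖ ≤ s / 2) : H y ≤ D * H x := by
  have hnorm := norm_nonneg (x - y)
  obtain ⟨hs0, hs1⟩ := hs
  calc H y ≤ φ (s - ‖x - y‖) := hsub.le_of_norm_sub_lt ⟨hs0.le, hs1⟩ hφs (by linarith)
    _ ≤ φ (s / 2) := hsub.majorant.strictAntiOn.antitoneOn ⟨by linarith, by linarith⟩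
        ⟨by linarith, by linarith⟩ (by linarith)
    _ ≤ D * H x := hφs ▸ hdbl s ⟨hs0, hs1⟩

lemma hasLocallyComparableTrunc (hsub : Subordinated H φ)
    (hdbl : ∃ D : ℝ≥0, 1 ≤ D ∧ ∀ θ ∈ Ioc (0 : ℝ) (1 / 2), φ (θ / 2) ≤ D * φ θ)
    (hlog : ∃ c : ℝ, 0 < c ∧ ∀ᶠ θ : ℝ in 𝓝[>] 0,
      c * Real.log (1 / θ) ≤ Real.log (φ θ).toReal) :
    HasLocallyComparableTrunc H := by
  obtain ⟨D, hD, hdbl⟩ := hdbl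
  obtain ⟨k, hk⟩ := hsub.majorant.exists_eventually_inv_pow_le hlog
  refine ⟨D, by exact_mod_cast hD, k + 1, ?_⟩
  filter_upwards [hk, eventually_ge_atTop 2] with a hak ha x y hxy
  have ha0 : 0 < a := by linarith
  refine trunc_le_mul_trunc hD fun hxa => ?_
  obtain ⟨s, hs, hφs⟩ := hsub.exists_eq x
  have hks : (a ^ k)⁻¹ ≤ s := hak s hs (hφs ▸ hxa)
  have hs0 : 0 < s := (inv_pos.2 (pow_pos ha0 k)).trans_le hks
  refine hsub.le_mul_of_norm_sub_le hdbl ⟨hs0, hs.2⟩ hφs (hxy.trans ?_)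
  calc (a ^ (k + 1))⁻¹ = (a ^ k)⁻¹ / a := by rw [pow_succ, mul_inv, div_eq_mul_inv]
    _ ≤ s / 2 := by gcongr

end Subordinated

end LocallyComparableTruncation

section Decay

variable {ρ : Measure UnitAddCircle} {H : UnitAddCircle → ℝ≥0∞}

namespace HasLocallyComparableTrunc

lemma exists_eventually_szegoError_le (hcomp : HasLocallyComparableTrunc H)
    (hH : Measurable H) (hρ : ∫⁻ t, EReal.exp (H t : EReal) ∂ρ < ∞) :
    ∃ B κ : ℝ, 0 ≤ B ∧ 0 < κ ∧ ∃ J : ℕ, J ≠ 0 ∧ ∀ᶠ a : ℝ in atTop, ∀ n : ℕ, a ^ J ≤ n →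
      szegoError ρ n ≤ B * Real.exp (-(κ * ∫ x, trunc H a x ∂haarAddCircle)) := by
  obtain ⟨D, hD, k, hk⟩ := hcomp
  refine ⟨4 * √(Real.exp 1 * (∫⁻ t, EReal.exp (H t : EReal) ∂ρ).toReal), 1 / (2 * D),
    by positivity, by positivity, 6 * k + 4, by omega, ?_⟩
  filter_upwards [hk, eventually_ge_atTop 24] with a hloc ha n hn
  have ha0 : 0 < a := by linarith
  set N : ℕ := ⌈a ^ (2 * k + 1)⌉₊
  have hpow : a ≤ a ^ (2 * k + 1) := le_self_pow₀ (by linarith) (by omega)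
  have haN : a ^ (2 * k + 1) ≤ N := Nat.le_ceil _
  have hN0 : N ≠ 0 := (Nat.ceil_pos.2 (by positivity)).ne'
  have haη : a ≤ 4 * ((a ^ k)⁻¹) ^ 2 * N :=
    calc a = ((a ^ k)⁻¹) ^ 2 * a ^ (2 * k + 1) := by field_simp; ring
      _ ≤ ((a ^ k)⁻¹) ^ 2 * N := by gcongr
      _ ≤ 4 * (((a ^ k)⁻¹) ^ 2 * N) := le_mul_of_one_le_left (by positivity) (by norm_num)
      _ = 4 * ((a ^ k)⁻¹) ^ 2 * N := (mul_assoc _ _ _).symm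
  have hNn : 3 * N ^ 3 ≤ n := by
    have hN2 : (N : ℝ) ≤ 2 * a ^ (2 * k + 1) := by
      linarith [Nat.ceil_lt_add_one (pow_nonneg ha0.le (2 * k + 1))]
    have : 3 * (N : ℝ) ^ 3 ≤ n :=
      calc 3 * (N : ℝ) ^ 3 ≤ 3 * (2 * a ^ (2 * k + 1)) ^ 3 := by gcongr
        _ = 24 * a ^ (6 * k + 3) := by ring
        _ ≤ a * a ^ (6 * k + 3) := by gcongr
        _ = a ^ (6 * k + 4) := by ring
        _ ≤ n := hn
    exact_mod_cast this
  refine (szegoError_le_of_locally_le_mul (measurable_trunc hH a) (trunc_nonneg H a)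
    (integrable_exp_trunc hH hρ a) hD (by positivity) hloc hN0
    (fun x => (trunc_le H ha0.le x).trans (hpow.trans haN))
    (fun x => (trunc_le H ha0.le x).trans haη) hNn).trans ?_
  rw [one_div_mul_eq_div]
  gcongr
  exact integral_exp_trunc_le hH hρ a

lemma exists_isBigO_szegoError (hcomp : HasLocallyComparableTrunc H) (hH : Measurable H)
    (hρ : ∫⁻ t, EReal.exp (H t : EReal) ∂ρ < ∞) :
    ∃ σ : ℝ, 0 < σ ∧ ∀ D : ℝ, 0 ≤ D →
      (∀ᶠ a : ℝ in atTop, ENNReal.ofReal D ≤ ENNReal.ofReal a * distribution H a) →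
      szegoError ρ =O[atTop] fun n : ℕ => (n : ℝ) ^ (-(σ * D)) := by
  obtain ⟨B, κ, hB, hκ, J, hJ, hszego⟩ := hcomp.exists_eventually_szegoError_le hH hρ
  have hJ0 : (0 : ℝ) < J := by positivity
  refine ⟨κ / J, by positivity, fun D hD hdist => ?_⟩
  obtain ⟨a₀, h₀⟩ := (hdist.and (eventually_gt_atTop 0)).exists_forall_of_atTop
  have ha₀ : 0 < a₀ := (h₀ a₀ le_rfl).2
  have hlevel : Tendsto (fun n : ℕ => (n : ℝ) ^ (J : ℝ)⁻¹) atTop atTop :=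
    (tendsto_rpow_atTop (inv_pos.2 hJ0)).comp tendsto_natCast_atTop_atTop
  refine .of_bound (B * a₀ ^ (κ * D)) ?_
  filter_upwards [hlevel.eventually (hszego.and (eventually_ge_atTop a₀))] with n ⟨hn, ha⟩
  set a : ℝ := (n : ℝ) ^ (J : ℝ)⁻¹ with hadef
  have ha0 : 0 < a := ha₀.trans_le ha
  have hintegral : D * Real.log (a / a₀) ≤ ∫ x, trunc H a x ∂haarAddCircle :=
    mul_log_le_integral_trunc hH hD ha₀ (fun t ht => (h₀ t ht).1) ha
  rw [Real.norm_of_nonneg (szegoError_nonneg ρ n), Real.norm_of_nonneg (by positivity)]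
  calc szegoError ρ n ≤ B * Real.exp (-(κ * ∫ x, trunc H a x ∂haarAddCircle)) :=
        hn n (Real.rpow_inv_natCast_pow n.cast_nonneg hJ).le
    _ ≤ B * Real.exp (-(κ * (D * Real.log (a / a₀)))) := by gcongr
    _ = B * (a / a₀) ^ (-(κ * D)) := by
        rw [Real.rpow_def_of_pos (div_pos ha0 ha₀)]; congr 2; ring
    _ = B * (a₀ ^ (κ * D) * a ^ (-(κ * D))) := by
        rw [Real.div_rpow ha0.le ha₀.le, Real.rpow_neg ha₀.le, div_inv_eq_mul, mul_comm (a ^ _)]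
    _ = B * a₀ ^ (κ * D) * (n : ℝ) ^ (-(κ / J * D)) := by
        rw [hadef, ← Real.rpow_mul n.cast_nonneg, mul_assoc]; congr 3; field_simp

end HasLocallyComparableTrunc

end Decay

lemma isLittleO_rpow_rpow_atTop {p q : ℝ} (hpq : p < q) :
    (fun x : ℝ => x ^ p) =o[atTop] fun x : ℝ => x ^ q := by
  have hone : (fun _ : ℝ => (1 : ℝ)) =o[atTop] fun x : ℝ => x ^ (q - p) :=
    (Asymptotics.isLittleO_one_left_iff ℝ).2
      (tendsto_norm_atTop_atTop.comp (tendsto_rpow_atTop (sub_pos.2 hpq)))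
  refine ((Asymptotics.isBigO_refl (fun x : ℝ => x ^ p) atTop).mul_isLittleO hone).congr'
    (.of_forall fun x => mul_one _) ?_
  filter_upwards [eventually_gt_atTop 0] with x hx
  rw [← Real.rpow_add hx, add_sub_cancel]

end SzegoMin

theorem mainTheorem9_general (ρ : Measure UnitAddCircle) (H : UnitAddCircle → ℝ≥0∞)
    (hH : Measurable H) (hρ : ∫⁻ t, EReal.exp (H t : EReal) ∂ρ < ∞)
    (hcomp : SzegoMin.HasLocallyComparableTrunc H) :
    (0 < liminf (fun a : ℝ => ENNReal.ofReal a * SzegoMin.distribution H a) atTop →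
      ∃ p : ℝ, 0 < p ∧ SzegoMin.szegoError ρ =O[atTop] fun n : ℕ => (n : ℝ) ^ (-p)) ∧
    (Tendsto (fun a : ℝ => ENNReal.ofReal a * SzegoMin.distribution H a) atTop (𝓝 ∞) →
      ∀ p : ℝ, 0 < p → SzegoMin.szegoError ρ =o[atTop] fun n : ℕ => (n : ℝ) ^ (-p)) := by
  obtain ⟨σ, hσ, hdecay⟩ := hcomp.exists_isBigO_szegoError hH hρ
  refine ⟨fun hlim => ?_, fun hlim p hp => ?_⟩
  · obtain ⟨D, hD0, hD⟩ := ENNReal.lt_iff_exists_nnreal_btwn.1 hlim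
    have hDpos : (0 : ℝ) < D := by exact_mod_cast hD0
    refine ⟨σ * D, by positivity, hdecay D hDpos.le ?_⟩
    filter_upwards [eventually_lt_of_lt_liminf hD] with a ha
    rw [ENNReal.ofReal_coe_nnreal]
    exact ha.le
  · have hO := hdecay ((p + 1) / σ) (by positivity)
      (hlim.eventually (eventually_ge_nhds ENNReal.ofReal_lt_top))
    rw [mul_div_cancel₀ _ hσ.ne'] at hO
    exact hO.trans_isLittleO
      ((SzegoMin.isLittleO_rpow_rpow_atTop (by linarith)).comp_tendsto tendsto_natCast_atTop_atTop)

theorem mainTheorem9 (ρ : Measure UnitAddCircle) [IsFiniteMeasure ρ]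
    (H : UnitAddCircle → ℝ≥0∞) (hH : Measurable H)
    (hHint : ∫⁻ t, H t ∂AddCircle.haarAddCircle = ∞)
    (hρ : ∫⁻ t, EReal.exp (H t : EReal) ∂ρ < ∞)
    (φ : ℝ → ℝ≥0∞) (hsub : SzegoMin.Subordinated H φ) (hreg : SzegoMin.Regular φ)
    (hlog : ∃ c : ℝ, 0 < c ∧ ∀ᶠ θ : ℝ in 𝓝[>] 0,
      c * Real.log (1 / θ) ≤ Real.log (φ θ).toReal) :
    (0 < liminf (fun a : ℝ => ENNReal.ofReal a * SzegoMin.distribution H a) atTop →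
      ∃ p : ℝ, 0 < p ∧ SzegoMin.szegoError ρ =O[atTop] fun n : ℕ => (n : ℝ) ^ (-p)) ∧
    (Tendsto (fun a : ℝ => ENNReal.ofReal a * SzegoMin.distribution H a) atTop (𝓝 ∞) →
      ∀ p : ℝ, 0 < p → SzegoMin.szegoError ρ =o[atTop] fun n : ℕ => (n : ℝ) ^ (-p)) :=
  mainTheorem9_general ρ H hH hρ (hsub.hasLocallyComparableTrunc hreg.exists_doubling hlog)
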